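/- Fix an integer $q\ge 2$ and a real number $0<A\le 1$. Let $\mathcal F$ be a family of finite non-empty $(q+1)$-regular graphs; loops and multiple edges are allowed. Each graph $X$ is given by its finite vertex set, a finite set of directed edges $e$, each with an origin $o(e)$, and an involution $e\mapsto\bar e$ (reversal of direction; a loop may also be its own reverse), with terminus $t(e)=o(\bar e)$; $(q+1)$-regular means that every vertex is the origin of exactly $q+1$ directed edges. Write $n=n_X$ for the number of vertices of $X$. Let $\lambda_0\ge\dots\ge\lambda_{n-1}$ be the eigenvalues, with multiplicity, of the normalized adjacency operator $\mathcal{A}f(x)=\frac1{q+1}\sum_{o(e)=x}f(t(e))$. The $p$-value $p_i$ of $\lambda_i$ is $2$ if $|\lambda_i|\le\frac{2\sqrt q}{q+1}$, and otherwise it is the unique $2<p_i\le\infty$ with $|\lambda_i|=\frac1{q+1}\left(q^{1/p_i}+q^{1-1/p_i}\right)$ (where $1/\infty=0$). The family $\mathcal F$ satisfies the Sarnak–Xue density property with parameter $A$ if for every $\epsilon>0$ there is a constant $C$, depending only on $\mathcal F$ and $\epsilon$ (and possibly on $q$ and $A$), such that for every real $p>2$ and every $X\in\mathcal F$, $$\#\{i: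 p_i\ge p\}\le C\,n^{1-A(1-2/p)+\epsilon}.$$ A non-backtracking cycle of length $k\ge1$ in $X$ is a sequence $(e_1,\dots,e_k)$ of directed edges such that $o(e_{i+1})=t(e_i)$ and $e_{i+1}\ne\bar e_i$ for all $i$ modulo $k$. Two cycles are equivalent if they are rotations of one another. A cycle is primitive if it is not equivalent to the concatenation of some non-backtracking cycle with itself $m\ge2$ times. Let $N_X(k)$ be the number of non-backtracking cycles of length $k$ and $\pi_X(k)$ the number of equivalence classes of primitive ones (both are $0$ for $k=0$). For $X\in\mathcal F$ put $k=k_X=2\lfloor A\log_q n\rfloor$. Then the following three conditions are equivalent: 1. $\mathcal F$ satisfies the Sarnak–Xue density property with parameter $A$; 2. for every $\epsilon>0$ there is a constant $C$ such that $\pi_X(k)\le C\,n^{1+\epsilon}q^{k/2}$ for every $X\in\mathcal F$; 3. for every $\epsilon>0$ there is a constant $C$ such that $N_X(k)\le C\,n^{1+\epsilon}q^{k/2}$ for every $X\in\mathcal F$. -/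

import Mathlib

open scoped ENNReal

/-- A graph given by its directed edges: `V` is the set of vertices, `E` the set of directed edges,
`origin e` the vertex from which `e` starts and `reverse e` the same edge taken in the opposite
direction. Loops and multiple edges are allowed. An ordinary loop consists of two directed edges;
a loop that is its own reverse (a half-loop) is allowed too. -/
structure DirGraph (V E : Type*) where
  origin : E → V
  reverse : E → E
  reverse_reverse : ∀ e, reverse (reverse e) = e

namespace DirGraph

variable {V E : Type*}

/-- The terminus of a directed edge. -/
def terminus (X : DirGraph V E) (e : E) : V := X.origin (X.reverse e)

/-- Every vertex is the origin of exactly `d` directed edges. -/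
def IsRegular (X : DirGraph V E) (d : ℕ) : Prop :=
  ∀ x : V, {e : E | X.origin e = x}.ncard = d

/-- The matrix of the normalized adjacency operator of a `(q+1)`-regular graph,
`(A f) x = (q + 1)⁻¹ * ∑ f (terminus e)`, the sum over the directed edges `e` with origin `x`
(see `normAdj_mulVec`). -/
noncomputable def normAdj (X : DirGraph V E) (q : ℕ) : Matrix V V ℝ :=
  Matrix.of fun x y => ({e : E | X.origin e = x ∧ X.terminus e = y}.ncard : ℝ) / (q + 1)

theorem normAdj_mulVec [Fintype V] [DecidableEq V] [Fintype E] (X : DirGraph V E) (q : ℕ)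
    (f : V → ℝ) (x : V) :
    (X.normAdj q).mulVec f x
      = 1 / (q + 1) * ∑ e : E with X.origin e = x, f (X.terminus e) := by
  classical
  rw [← Finset.sum_fiberwise _ (fun e => X.terminus e), Finset.mul_sum]
  refine Finset.sum_congr rfl fun y _ => ?_
  have h : {e : E | X.origin e = x ∧ X.terminus e = y}.ncard
      = ({e ∈ ({e : E | X.origin e = x} : Finset E) | X.terminus e = y}).card := by
    rw [← Set.ncard_coe_finset]
    congr 1
    ext e
    simp
  rw [Finset.sum_congr rfl (g := fun _ => f y)
    (fun e he => by rw [(Finset.mem_filter.mp he).2])]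
  simp only [normAdj, Matrix.of_apply, h, Finset.sum_const, nsmul_eq_mul]
  ring

theorem normAdj_isHermitian (X : DirGraph V E) (q : ℕ) : (X.normAdj q).IsHermitian := by
  ext x y
  simp only [normAdj, Matrix.conjTranspose_apply, Matrix.of_apply, star_trivial]
  congr 2
  refine Set.ncard_congr (fun e _ => X.reverse e) ?_ ?_ ?_
  · rintro e ⟨h1, h2⟩
    refine ⟨h2, ?_⟩
    simpa [terminus, X.reverse_reverse] using h1
  · intro a b _ _ h
    rw [← X.reverse_reverse a, h, X.reverse_reverse]
  · rintro e ⟨h1, h2⟩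
    refine ⟨X.reverse e, ⟨h2, ?_⟩, X.reverse_reverse e⟩
    simpa [terminus, X.reverse_reverse] using h1

/-- The eigenvalues of the normalized adjacency operator, listed with multiplicity (the index
set has as many elements as there are vertices). -/
noncomputable def adjEigenvalues [Fintype V] [DecidableEq V] (X : DirGraph V E) (q : ℕ) : V → ℝ :=
  (X.normAdj_isHermitian q).eigenvalues

/-- The edge `e'` may follow `e` in a non-backtracking path. -/
def NBStep (X : DirGraph V E) (e e' : E) : Prop :=
  X.origin e' = X.terminus e ∧ e' ≠ X.reverse e

/-- A non-backtracking cycle: a non-empty list `[e₁, …, eₖ]` of directed edges such that each edge,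
and cyclically the first edge after the last, continues the preceding edge without being its
reverse. -/
def IsNBCycle (X : DirGraph V E) (l : List E) : Prop :=
  l ≠ [] ∧ Cycle.Chain X.NBStep (l : Cycle E)

/-- A non-backtracking cycle is primitive if it is not a rotation of a proper power (the
concatenation with itself `m ≥ 2` times) of another non-backtracking cycle. -/
def IsPrimitiveCycle (X : DirGraph V E) (l : List E) : Prop :=
  X.IsNBCycle l ∧
    ¬ ∃ (l' : List E) (m : ℕ), 2 ≤ m ∧ X.IsNBCycle l' ∧ l ~r (List.replicate m l').flatten

/-- `N_X(k)`: the number of non-backtracking cycles of length `k`. -/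
noncomputable def numCycles (X : DirGraph V E) (k : ℕ) : ℕ :=
  {l : List E | l.length = k ∧ X.IsNBCycle l}.ncard

/-- `π_X(k)`: the number of equivalence classes, up to rotation, of primitive non-backtracking
cycles of length `k`; `Cycle E` is the quotient of `List E` by rotation. -/
noncomputable def numPrimitiveClasses (X : DirGraph V E) (k : ℕ) : ℕ :=
  ((fun l : List E => (l : Cycle E)) '' {l : List E | l.length = k ∧ X.IsPrimitiveCycle l}).ncard

end DirGraph

/-- The `p`-value, in `[2, ∞]`, of an eigenvalue `lam` of the normalized adjacency operator: it is `2`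
when `|lam| ≤ 2 √q / (q + 1)`, and otherwise it is the unique `2 < p ≤ ∞` such that
`|lam| = (q ^ (1 / p) + q ^ (1 - 1 / p)) / (q + 1)`, with `1 / ∞ = 0` (see `existsUnique_pValue`);
the supremum below is over a set with one element. -/
noncomputable def pValue (q : ℕ) (lam : ℝ) : ℝ≥0∞ :=
  open Classical in
  if |lam| ≤ 2 / ((q : ℝ) + 1) * √q then 2
  else sSup {p : ℝ≥0∞ | 2 < p ∧
    |lam| = 1 / ((q : ℝ) + 1) * ((q : ℝ) ^ (p⁻¹).toReal + (q : ℝ) ^ (1 - (p⁻¹).toReal))}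

theorem existsUnique_pValue (q : ℕ) (hq : 2 ≤ q) (lam : ℝ)
    (h : 2 / ((q : ℝ) + 1) * √q < |lam|) (h1 : |lam| ≤ 1) :
    ∃! p : ℝ≥0∞, 2 < p ∧
      |lam| = 1 / ((q : ℝ) + 1) * ((q : ℝ) ^ (p⁻¹).toReal + (q : ℝ) ^ (1 - (p⁻¹).toReal)) := by
  have hq1 : (1 : ℝ) < q := by exact_mod_cast hq
  have hq0 : (0 : ℝ) < q := by linarith
  have hpos : (0 : ℝ) < (q : ℝ) + 1 := by linarith
  have half : ∀ p : ℝ≥0∞, 2 < p → (p⁻¹).toReal < 1 / 2 := by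
    intro p hp
    have : p⁻¹ < 2⁻¹ := ENNReal.inv_lt_inv.mpr hp
    have := (ENNReal.toReal_lt_toReal (ne_top_of_lt this) (by simp)).mpr this
    simpa using this
  have e0 : ((q : ℝ) ^ (1 / 2 : ℝ)) = √q := (Real.sqrt_eq_rpow _).symm
  refine existsUnique_of_exists_of_unique ?_ ?_
  · have hc : ContinuousOn (fun u : ℝ => 1 / ((q : ℝ) + 1) * ((q : ℝ) ^ u + (q : ℝ) ^ (1 - u)))
        (Set.Icc 0 (1 / 2)) := by
      apply Continuous.continuousOn
      have := Real.continuous_const_rpow hq0.ne'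
      fun_prop
    have hmem : |lam| ∈ Set.Icc (1 / ((q : ℝ) + 1) * ((q : ℝ) ^ (1 / 2 : ℝ) + (q : ℝ) ^ (1 - 1 / 2 : ℝ)))
        (1 / ((q : ℝ) + 1) * ((q : ℝ) ^ (0 : ℝ) + (q : ℝ) ^ (1 - 0 : ℝ))) := by
      constructor
      · rw [show (1 - 1 / 2 : ℝ) = 1 / 2 by norm_num, e0]
        have : 1 / ((q : ℝ) + 1) * (√q + √q) = 2 / ((q : ℝ) + 1) * √q := by ring
        linarith
      · simp only [Real.rpow_zero, sub_zero, Real.rpow_one]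
        rw [add_comm (1 : ℝ), one_div, inv_mul_cancel₀ hpos.ne']
        exact h1
    obtain ⟨u, ⟨hu0, hu1⟩, hu⟩ := intermediate_value_Icc' (by norm_num) hc hmem
    have hu2 : u < 1 / 2 := by
      refine lt_of_le_of_ne hu1 fun hu' => ?_
      subst hu'
      beta_reduce at hu
      rw [show (1 - 1 / 2 : ℝ) = 1 / 2 by norm_num, e0] at hu
      have : 1 / ((q : ℝ) + 1) * (√q + √q) = 2 / ((q : ℝ) + 1) * √q := by ring
      linarith
    refine ⟨(ENNReal.ofReal u)⁻¹, ?_, ?_⟩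
    · rw [← inv_inv (2 : ℝ≥0∞), ENNReal.inv_lt_inv, ← ENNReal.ofReal_ofNat,
        ← ENNReal.ofReal_inv_of_pos (by norm_num)]
      exact (ENNReal.ofReal_lt_ofReal_iff (by norm_num)).mpr (by simpa using hu2)
    · rw [inv_inv, ENNReal.toReal_ofReal hu0]
      exact hu.symm
  · rintro p p' ⟨hp, hpe⟩ ⟨hp', hpe'⟩
    have key : ∀ r : ℝ≥0∞, 2 < r → (q : ℝ) ^ (r⁻¹).toReal < √q := fun r hr => by
      rw [← e0]
      exact Real.rpow_lt_rpow_of_exponent_lt hq1 (half r hr)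
    have a := key p hp
    have b := key p' hp'
    have hs : √(q : ℝ) * √q = q := Real.mul_self_sqrt hq0.le
    rw [hpe, Real.rpow_sub hq0, Real.rpow_sub hq0, Real.rpow_one] at hpe'
    have hx : 0 < (q : ℝ) ^ (p⁻¹).toReal := Real.rpow_pos_of_pos hq0 _
    have hy : 0 < (q : ℝ) ^ (p'⁻¹).toReal := Real.rpow_pos_of_pos hq0 _
    have hxy : (q : ℝ) ^ (p⁻¹).toReal = (q : ℝ) ^ (p'⁻¹).toReal := by
      generalize (q : ℝ) ^ (p⁻¹).toReal = s at *
      generalize (q : ℝ) ^ (p'⁻¹).toReal = t at *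
      have h3 := mul_left_cancel₀ (one_div_pos.mpr hpos).ne' hpe'
      have h4 : (s - t) * (s * t - q) = 0 := by
        field_simp at h3
        linear_combination h3
      have h5 : s * t < q := by
        rw [← hs]
        exact mul_lt_mul'' a b hx.le hy.le
      rcases mul_eq_zero.mp h4 with h | h <;> linarith
    have hu := (Real.rpow_right_inj hq0 hq1.ne').mp hxy
    have := (ENNReal.toReal_eq_toReal_iff' (by simpa using (by positivity : (0 : ℝ≥0∞) < 2).trans hp |>.ne')
      (by simpa using (by positivity : (0 : ℝ≥0∞) < 2).trans hp' |>.ne')).mp hu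
    exact inv_injective this

/-- The Sarnak–Xue density property with parameter `A` of a family `X` of `(q+1)`-regular graphs. The
constant depends on the family and on `ε` only. -/
def SarnakXueDensity {ι : Type*} {V E : ι → Type*} [∀ i, Fintype (V i)] [∀ i, DecidableEq (V i)]
    (X : ∀ i, DirGraph (V i) (E i)) (q : ℕ) (A : ℝ) : Prop :=
  ∀ ε : ℝ, 0 < ε → ∃ C : ℝ, ∀ p : ℝ, 2 < p → ∀ i : ι,
    ({j : V i | ENNReal.ofReal p ≤ pValue q ((X i).adjEigenvalues q j)}.ncard : ℝ)
      ≤ C * (Fintype.card (V i) : ℝ) ^ (1 - A * (1 - 2 / p) + ε)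

/-- The length `2 ⌊A log_q n⌋`. -/
noncomputable def cycleLength (q : ℕ) (A : ℝ) (n : ℕ) : ℕ :=
  2 * ⌊A * Real.logb q n⌋₊

/-! Cycle counts are spectral moments. Let `B` be the non-backtracking matrix on directed edges, so
that `N(k) = tr B ^ k` for `k ≥ 1`. An Ihara–Bass identity, proved here without determinants, gives
for `j ≥ 1` that `N(2j) = ∑ L_{2j}((q+1)λ_i) + (q-1)n`, where `L_k` is `lucasSeq`
(`trace_nbMatrix_pow`). Put `t_i = 1 - 2/p_i ∈ [0, 1]`. A summand is `q^j (q^{j t_i} + q^{-j t_i})`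
if `p_i > 2` and at most `2 q^j` in absolute value if `p_i = 2`. Hence `N(2j) / q^j` equals `∑
(q^j)^{t_i}` up to a constant factor and an error `O(n)`.

For `j = ⌊A log_q n⌋` the base `q^j` is `n^A` up to a factor `q`, so condition 3 says `∑ n^{A t_i} ≪
n^{1+ε}` (`spectralSum_iff_numCycles`). This is equivalent to the density property: Chebyshev's
inequality gives one direction, and cutting `[0, 1]` into finitely many slices gives the other
(`sarnakXueDensity_iff_spectralSum`).

Finally, a non-primitive cycle is a rotated power of a cycle of length at most `j`. The trivial
bound `N(d) ≤ (q+1) n q^d` makes these negligible: factors polynomial in `j ≪ log n` are absorbed by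
`n^ε` (`numPrimitiveClasses_iff_numCycles`). -/

/-! ### Lucas sequences of matrices and their traces. -/

/-- The sequence `α ^ k + β ^ k`, where `α + β = μ` and `α * β = q`. -/
def lucasSeq {R : Type*} [Ring R] (q : ℕ) (μ : R) : ℕ → R
  | 0 => 2
  | 1 => μ
  | k + 2 => μ * lucasSeq q μ (k + 1) - q * lucasSeq q μ k

theorem map_lucasSeq {R S : Type*} [Ring R] [Ring S] (φ : R →+* S) (q : ℕ) (μ : R) (k : ℕ) :
    φ (lucasSeq q μ k) = lucasSeq q (φ μ) k := by
  induction k using Nat.twoStepInduction with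
  | zero => simpa [lucasSeq] using map_ofNat φ 2
  | one => simp [lucasSeq]
  | more k h1 h2 => simp [lucasSeq, h1, h2]

-- Conjugation by the eigenvector matrix is a ring automorphism, and ring homomorphisms commute with
-- `lucasSeq`, so everything reduces to a diagonal matrix.
open Matrix in
theorem Matrix.IsHermitian.trace_lucasSeq {n : Type*} [Fintype n] [DecidableEq n]
    {M : Matrix n n ℝ} (hM : M.IsHermitian) (q : ℕ) (c : ℝ) (k : ℕ) :
    (lucasSeq q (c • M) k).trace = ∑ i, lucasSeq q (c * hM.eigenvalues i) k := by
  obtain ⟨U, V, hUV, hVU, h⟩ : ∃ U V : Matrix n n ℝ, U * V = 1 ∧ V * U = 1 ∧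
      M = U * diagonal hM.eigenvalues * V := by
    refine ⟨hM.eigenvectorUnitary, star (hM.eigenvectorUnitary : Matrix n n ℝ), by simp, by simp, ?_⟩
    simpa [Unitary.conjStarAlgAut_apply] using hM.spectral_theorem
  let u : (Matrix n n ℝ)ˣ := ⟨U, V, hUV, hVU⟩
  let φ : Matrix n n ℝ ≃+* Matrix n n ℝ :=
    { toFun := fun N => U * N * V
      invFun := fun N => V * N * U
      left_inv := fun N => by
        calc V * (U * N * V) * U = (V * U) * N * (V * U) := by noncomm_ring
          _ = N := by simp [hVU]
      right_inv := fun N => by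
        calc U * (V * N * U) * V = (U * V) * N * (U * V) := by noncomm_ring
          _ = N := by simp [hUV]
      map_mul' := fun N N' => by
        calc U * (N * N') * V = U * N * 1 * N' * V := by noncomm_ring
          _ = U * N * V * (U * N' * V) := by rw [← hVU]; noncomm_ring
      map_add' := fun N N' => by noncomm_ring }
  have hφ : c • M = φ.toRingHom (diagonal fun i => c * hM.eigenvalues i) := by
    change c • M = U * (diagonal fun i => c * hM.eigenvalues i) * V
    rw [show (fun i => c * hM.eigenvalues i) = c • hM.eigenvalues from rfl, diagonal_smul]
    simp only [Matrix.mul_smul, Matrix.smul_mul]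
    rw [← h]
  rw [hφ, ← map_lucasSeq]
  change (U * _ * V).trace = _
  rw [Matrix.trace_mul_comm, ← Matrix.mul_assoc, hVU, one_mul]
  have hd : (diagonal fun i => c * hM.eigenvalues i)
      = diagonalRingHom n ℝ (fun i => c * hM.eigenvalues i) := rfl
  rw [hd, ← map_lucasSeq]
  change (diagonal _).trace = _
  rw [trace_diagonal]
  refine Finset.sum_congr rfl fun i _ => ?_
  exact map_lucasSeq (Pi.evalRingHom (fun _ => ℝ) i) q (fun i => c * hM.eigenvalues i) k

/-! ### The Ihara–Bass trace identity as matrix algebra. -/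

section Hecke

open Matrix

variable {V E : Type*} [Fintype V] [DecidableEq V] [Fintype E] [DecidableEq E]
  {q : ℕ} {J : Matrix E E ℝ} {O : Matrix E V ℝ} {S : Matrix V E ℝ}

/-- The row of `S * J` at `x` marks the edges ending at `x`. Each edge leaving `x` continues all of
these but its own reverse, that is, `q` of them. -/
theorem incidence_mul_pow_succ (hJ : J * J = 1) (hS : S * O = ((q : ℝ) + 1) • 1) (k : ℕ) :
    S * J * (J * (O * S - 1)) ^ (k + 1) = (q : ℝ) • (S * (J * (O * S - 1)) ^ k) := by
  have h : S * (O * S - 1) = (q : ℝ) • S := by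
    rw [Matrix.mul_sub, ← Matrix.mul_assoc, hS, Matrix.smul_mul, Matrix.one_mul, Matrix.mul_one,
      add_smul, one_smul, add_sub_cancel_right]
  rw [pow_succ', ← Matrix.mul_assoc, ← Matrix.mul_assoc, Matrix.mul_assoc S J J, hJ,
    Matrix.mul_one, h, Matrix.smul_mul]

/-- For a graph, `S * B ^ k * (J * O)` counts non-backtracking paths of `k + 1` edges between two
vertices. Prepend an edge to such a path and subtract the extensions that backtrack. -/
theorem incidence_recurrence (hJ : J * J = 1) (hS : S * O = ((q : ℝ) + 1) • 1) (k : ℕ) :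
    S * (J * (O * S - 1)) ^ (k + 2) * (J * O)
      = (S * J * O) * (S * (J * (O * S - 1)) ^ (k + 1) * (J * O))
        - (q : Matrix V V ℝ) * (S * (J * (O * S - 1)) ^ k * (J * O)) := by
  have h := incidence_mul_pow_succ hJ hS k
  rw [pow_succ' _ (k + 1)]
  set B := J * (O * S - 1) with hB
  have : S * (B * B ^ (k + 1)) = S * J * O * (S * B ^ (k + 1)) - S * J * B ^ (k + 1) := by
    rw [← Matrix.mul_assoc]
    nth_rw 1 [hB]
    rw [← Matrix.mul_assoc, Matrix.mul_sub, Matrix.mul_one, Matrix.sub_mul]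
    simp only [Matrix.mul_assoc]
  rw [this, h, Matrix.sub_mul, Matrix.smul_mul, Matrix.mul_assoc (S * J * O)]
  congr 1
  rw [← nsmul_eq_mul, Nat.cast_smul_eq_nsmul]

/-- Both sides obey the same second-order recurrence, so the cases `k = 0, 1` decide. It is the
passage from Chebyshev polynomials of the second kind to those of the first. -/
theorem incidence_sub_eq_lucasSeq (hJ : J * J = 1) (hS : S * O = ((q : ℝ) + 1) • 1) (k : ℕ) :
    S * (J * (O * S - 1)) ^ (k + 2) * (J * O)
        - (q : Matrix V V ℝ) * (S * (J * (O * S - 1)) ^ k * (J * O))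
      = lucasSeq q (S * J * O) (k + 3) - lucasSeq q (S * J * O) (k + 1) := by
  have hrec := incidence_recurrence hJ hS
  have h0 : S * (J * (O * S - 1)) ^ 0 * (J * O) = S * J * O := by
    rw [pow_zero, Matrix.mul_one, Matrix.mul_assoc]
  have h1 : S * (J * (O * S - 1)) ^ 1 * (J * O)
      = (S * J * O) * (S * J * O) - ((q : Matrix V V ℝ) + 1) := by
    have : S * (J * (O * S - 1)) ^ 1 * (J * O)
        = (S * J * O) * (S * J * O) - S * (J * J) * O := by
      rw [pow_one, Matrix.mul_sub, Matrix.mul_one, Matrix.mul_sub, Matrix.sub_mul]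
      simp only [Matrix.mul_assoc]
    rw [this, hJ, Matrix.mul_one, hS, add_smul, one_smul, Nat.cast_smul_eq_nsmul, nsmul_eq_mul,
      mul_one]
  generalize ha : (fun k => S * (J * (O * S - 1)) ^ k * (J * O)) = a at *
  have ha' : ∀ k, S * (J * (O * S - 1)) ^ k * (J * O) = a k := fun k => by rw [← ha]
  simp only [ha'] at *
  clear ha ha'
  generalize S * J * O = M at *
  have hq : ∀ N : Matrix V V ℝ, M * ((q : Matrix V V ℝ) * N) = q * (M * N) := fun N => by
    rw [← mul_assoc, ← mul_assoc, Nat.cast_comm]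
  have hq' : M * (q : Matrix V V ℝ) = q * M := (Nat.cast_commute q M).eq.symm
  induction k using Nat.twoStepInduction with
  | zero =>
    simp only [hrec, h0, h1, lucasSeq, zero_add, mul_sub, mul_add, hq, mul_one]
    noncomm_ring
    rw [hq']
    abel
  | one =>
    simp only [hrec, h0, h1, lucasSeq, zero_add, mul_sub, mul_add, hq, mul_one, mul_two, hq']
    abel
  | more k ih1 ih2 =>
    have e : a (k + 2 + 2) - q * a (k + 2)
        = M * (a (k + 1 + 2) - q * a (k + 1)) - q * (a (k + 2) - q * a k) := by
      rw [hrec (k + 2), hrec k]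
      simp only [mul_sub, hq]
      abel
    have l1 : lucasSeq q M (k + 2 + 3)
        = M * lucasSeq q M (k + 1 + 3) - q * lucasSeq q M (k + 3) := rfl
    have l2 : lucasSeq q M (k + 2 + 1)
        = M * lucasSeq q M (k + 1 + 1) - q * lucasSeq q M (k + 1) := rfl
    rw [e, ih1, ih2, l1, l2, mul_sub, mul_sub]
    abel

/-- Since `J * O * S = B + J`, one has `B * B - 1 = B * (J * O * S) - J * O * S * J`. After
multiplication by `B ^ (k + 1)`, cyclicity of the trace turns both terms into path matrices. -/
theorem trace_pow_add_two_sub (hJ : J * J = 1) (hS : S * O = ((q : ℝ) + 1) • 1) (k : ℕ) :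
    ((J * (O * S - 1)) ^ (k + 3)).trace - ((J * (O * S - 1)) ^ (k + 1)).trace
      = (lucasSeq q (S * J * O) (k + 3)).trace - (lucasSeq q (S * J * O) (k + 1)).trace := by
  rw [← Matrix.trace_sub, ← Matrix.trace_sub, ← incidence_sub_eq_lucasSeq hJ hS]
  have h := incidence_mul_pow_succ hJ hS k
  set B := J * (O * S - 1) with hB
  have hBB : B * B - 1 = B * (J * O * S) - J * O * S * J := by
    have h1 : J * O * S = B + J := by
      rw [hB, Matrix.mul_sub, Matrix.mul_one, Matrix.mul_assoc]
      abel
    rw [h1, mul_add, add_mul, hJ]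
    abel
  have : B ^ (k + 3) - B ^ (k + 1) = B ^ (k + 2) * (J * O) * S - B ^ (k + 1) * (J * O) * (S * J) := by
    calc _ = B ^ (k + 1) * (B * B - 1) := by noncomm_ring
      _ = _ := by
        rw [hBB, mul_sub, pow_succ B (k + 1)]
        simp only [Matrix.mul_assoc]
  rw [this, Matrix.trace_sub, Matrix.trace_sub, Matrix.trace_mul_comm _ S,
    Matrix.trace_mul_comm _ (S * J), ← Matrix.mul_assoc, ← Matrix.mul_assoc (S * J), h,
    Matrix.smul_mul]
  congr 2
  rw [← nsmul_eq_mul, Nat.cast_smul_eq_nsmul]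

theorem trace_pow_two (hJ : J * J = 1) (hS : S * O = ((q : ℝ) + 1) • 1)
    (hE : (Fintype.card E : ℝ) = (q + 1) * Fintype.card V) :
    ((J * (O * S - 1)) ^ 2).trace
      = (lucasSeq q (S * J * O) 2).trace + (q - 1) * Fintype.card V := by
  have h1 : (J * (O * S - 1)) ^ 2 = (J * O) * (S * J * O * S) - J * (O * (S * J))
      - J * J * (O * S) + J * J := by
    rw [pow_two, Matrix.mul_sub, Matrix.mul_one, Matrix.sub_mul, Matrix.mul_sub, Matrix.mul_sub]
    simp only [Matrix.mul_assoc]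
    abel
  have h2 : (S * J * O * S * (J * O)) = S * J * O * (S * J * O) := by
    simp only [Matrix.mul_assoc]
  have h3 : O * (S * J) * J = O * S := by
    rw [Matrix.mul_assoc, Matrix.mul_assoc, hJ, Matrix.mul_one]
  have h4 : (O * S).trace = (q + 1) * Fintype.card V := by
    rw [Matrix.trace_mul_comm, hS, Matrix.trace_smul, Matrix.trace_one, smul_eq_mul]
  have h5 : ((q : Matrix V V ℝ) * 2).trace = (q : ℝ) * 2 * Fintype.card V := by
    have : (q : Matrix V V ℝ) * 2 = ((q : ℝ) * 2) • (1 : Matrix V V ℝ) := by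
      rw [mul_smul, Nat.cast_smul_eq_nsmul, nsmul_eq_mul, ofNat_smul_eq_nsmul ℝ 2, nsmul_eq_mul]
      simp
    rw [this, Matrix.trace_smul, Matrix.trace_one, smul_eq_mul]
  rw [h1, Matrix.trace_add, Matrix.trace_sub, Matrix.trace_sub, Matrix.trace_mul_comm (J * O),
    h2, Matrix.trace_mul_comm J, h3, hJ, Matrix.one_mul, h4, Matrix.trace_one, hE, lucasSeq,
    Matrix.trace_sub]
  simp only [lucasSeq]
  rw [h5]
  ring

/-- The trace differences in steps of two agree, so the discrepancy at length 2 persists. For odd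
lengths it would be `-tr J`, which depends on half-loops. -/
theorem trace_pow_even (hJ : J * J = 1) (hS : S * O = ((q : ℝ) + 1) • 1)
    (hE : (Fintype.card E : ℝ) = (q + 1) * Fintype.card V) (j : ℕ) :
    ((J * (O * S - 1)) ^ (2 * j + 2)).trace
      = (lucasSeq q (S * J * O) (2 * j + 2)).trace + (q - 1) * Fintype.card V := by
  induction j with
  | zero => exact trace_pow_two hJ hS hE
  | succ j ih =>
    have := trace_pow_add_two_sub (q := q) hJ hS (2 * j + 1)
    rw [show 2 * (j + 1) + 2 = 2 * j + 1 + 3 by ring]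
    rw [show 2 * j + 1 + 1 = 2 * j + 2 by ring] at this
    linarith

end Hecke

/-! ### The incidence, reversal and non-backtracking matrices of a graph. -/

namespace DirGraph

open Matrix

variable {V E : Type*} [Fintype V] [DecidableEq V] [Fintype E] [DecidableEq E]

/-- The incidence matrix of edges and their origins. -/
def originMatrix (X : DirGraph V E) : Matrix E V ℝ :=
  of fun e x => if X.origin e = x then 1 else 0

/-- The permutation matrix of the reversal of edges. -/
def reverseMatrix (X : DirGraph V E) : Matrix E E ℝ :=
  of fun e e' => if X.reverse e = e' then 1 else 0

/-- The matrix of the relation `NBStep`. -/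
def nbMatrix (X : DirGraph V E) : Matrix E E ℝ :=
  of fun e e' => if X.origin e' = X.terminus e ∧ e' ≠ X.reverse e then 1 else 0

omit [Fintype V] [DecidableEq V] in
theorem reverseMatrix_mul_apply {n : Type*} (X : DirGraph V E) (N : Matrix E n ℝ) (e : E) (y : n) :
    (X.reverseMatrix * N) e y = N (X.reverse e) y := by
  simp only [reverseMatrix, Matrix.mul_apply, of_apply, ite_mul, one_mul, zero_mul,
    Finset.sum_ite_eq, Finset.mem_univ, if_true]

omit [Fintype V] [DecidableEq V] in
theorem reverseMatrix_mul_self (X : DirGraph V E) : X.reverseMatrix * X.reverseMatrix = 1 := by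
  ext e e'
  rw [reverseMatrix_mul_apply]
  simp [reverseMatrix, X.reverse_reverse, Matrix.one_apply]

omit [Fintype V] [DecidableEq E] in
theorem card_filter_origin {X : DirGraph V E} {d : ℕ} (hX : X.IsRegular d) (x : V) :
    ({e : E | X.origin e = x} : Finset E).card = d := by
  rw [← hX x, ← Set.ncard_coe_finset]
  simp

omit [DecidableEq E] in
theorem card_edges {X : DirGraph V E} {d : ℕ} (hX : X.IsRegular d) :
    Fintype.card E = d * Fintype.card V := by
  rw [← Finset.card_univ, Finset.card_eq_sum_card_fiberwise (f := X.origin) (t := Finset.univ)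
    (by simp)]
  simp [card_filter_origin hX, mul_comm]

omit [Fintype V] [DecidableEq E] in
theorem originMatrix_transpose_mul {X : DirGraph V E} {q : ℕ} (hX : X.IsRegular (q + 1)) :
    X.originMatrixᵀ * X.originMatrix = ((q : ℝ) + 1) • 1 := by
  ext x y
  have h : ∀ e, X.originMatrixᵀ x e * X.originMatrix e y
      = if X.origin e = x then (if x = y then 1 else 0) else 0 := fun e => by
    by_cases h : X.origin e = x <;> simp [originMatrix, h]
  rw [Matrix.mul_apply, Finset.sum_congr rfl fun e _ => h e, ← Finset.sum_filter,
    Finset.sum_const, card_filter_origin hX]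
  simp [Matrix.one_apply]

omit [Fintype E] [DecidableEq E] in
theorem originMatrix_mul_transpose_apply (X : DirGraph V E) (e e' : E) :
    (X.originMatrix * X.originMatrixᵀ) e e' = if X.origin e' = X.origin e then 1 else 0 := by
  simp only [originMatrix, Matrix.mul_apply, of_apply, transpose_apply, ite_mul, one_mul, zero_mul,
    Finset.sum_ite_eq, Finset.mem_univ, if_true]

theorem nbMatrix_eq (X : DirGraph V E) :
    X.nbMatrix = X.reverseMatrix * (X.originMatrix * X.originMatrixᵀ - 1) := by
  ext e e'
  rw [reverseMatrix_mul_apply, Matrix.sub_apply, originMatrix_mul_transpose_apply, Matrix.one_apply]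
  simp only [nbMatrix, of_apply, terminus]
  by_cases h : X.reverse e = e'
  · subst h; simp
  · simp [h, Ne.symm h]

omit [Fintype V] in
theorem normAdj_eq (X : DirGraph V E) (q : ℕ) :
    X.originMatrixᵀ * X.reverseMatrix * X.originMatrix = ((q : ℝ) + 1) • X.normAdj q := by
  ext x y
  have hq : (q : ℝ) + 1 ≠ 0 := by positivity
  have hc : {e : E | X.origin e = x ∧ X.terminus e = y}.ncard
      = ({e : E | X.origin e = x ∧ X.terminus e = y} : Finset E).card := by
    rw [← Set.ncard_coe_finset]
    simp
  rw [Matrix.mul_assoc, Matrix.mul_apply, Matrix.smul_apply, normAdj, of_apply, hc, smul_eq_mul,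
    mul_div_cancel₀ _ hq, Finset.card_filter, Nat.cast_sum]
  refine Finset.sum_congr rfl fun e _ => ?_
  rw [reverseMatrix_mul_apply]
  by_cases h : X.origin e = x <;> simp [originMatrix, terminus, h]

omit [Fintype V] in
theorem nbMatrix_mulVec_one {X : DirGraph V E} {q : ℕ} (hX : X.IsRegular (q + 1)) :
    X.nbMatrix *ᵥ 1 = (q : ℝ) • 1 := by
  ext e
  have h : ({e' : E | X.origin e' = X.terminus e ∧ e' ≠ X.reverse e} : Finset E)
      = ({e' : E | X.origin e' = X.terminus e} : Finset E).erase (X.reverse e) := by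
    ext e'
    simp [and_comm]
  have hc : ({e' : E | X.origin e' = X.terminus e ∧ e' ≠ X.reverse e} : Finset E).card = q := by
    have hm : X.reverse e ∈ ({e' : E | X.origin e' = X.terminus e} : Finset E) :=
      Finset.mem_filter.mpr ⟨Finset.mem_univ _, rfl⟩
    rw [h, Finset.card_erase_of_mem hm, card_filter_origin hX, Nat.add_sub_cancel]
  simp only [mulVec, dotProduct, nbMatrix, of_apply, Pi.one_apply, mul_one, Finset.sum_boole, hc,
    Pi.smul_apply, smul_eq_mul]

/-- The entries are nonnegative and every row of the power sums to `q ^ k`; there are `(q + 1) n`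
rows. -/
theorem trace_nbMatrix_pow_le {X : DirGraph V E} {q : ℕ} (hX : X.IsRegular (q + 1)) (k : ℕ) :
    (X.nbMatrix ^ k).trace ≤ (q + 1) * Fintype.card V * (q : ℝ) ^ k := by
  have hpow : X.nbMatrix ^ k *ᵥ 1 = (q : ℝ) ^ k • 1 := by
    induction k with
    | zero => simp
    | succ k ih =>
      rw [pow_succ, ← mulVec_mulVec, nbMatrix_mulVec_one hX, mulVec_smul, ih, smul_smul, pow_succ,
        mul_comm]
  have hnn : ∀ e e', 0 ≤ (X.nbMatrix ^ k) e e' := by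
    clear hpow
    induction k with
    | zero => intro e e'; rw [pow_zero, Matrix.one_apply]; split <;> simp
    | succ k ih =>
      intro e e'
      rw [pow_succ, Matrix.mul_apply]
      refine Finset.sum_nonneg fun j _ => mul_nonneg (ih e j) ?_
      rw [nbMatrix, of_apply]
      split <;> simp
  calc (X.nbMatrix ^ k).trace ≤ ∑ e, (X.nbMatrix ^ k *ᵥ 1) e := by
        refine Finset.sum_le_sum fun e _ => ?_
        simp only [mulVec, dotProduct, Pi.one_apply, mul_one, diag_apply]
        exact Finset.single_le_sum (fun e' _ => hnn e e') (Finset.mem_univ e)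
    _ = (q + 1) * Fintype.card V * (q : ℝ) ^ k := by
        rw [hpow]
        simp [card_edges hX]

/-- The trace formula for non-backtracking cycles of even length. -/
theorem trace_nbMatrix_pow {X : DirGraph V E} {q : ℕ} (hX : X.IsRegular (q + 1)) (j : ℕ) :
    (X.nbMatrix ^ (2 * j + 2)).trace
      = ∑ i, lucasSeq q (((q : ℝ) + 1) * X.adjEigenvalues q i) (2 * j + 2)
        + (q - 1) * Fintype.card V := by
  rw [nbMatrix_eq, trace_pow_even X.reverseMatrix_mul_self (originMatrix_transpose_mul hX)
    (by rw [card_edges hX]; push_cast; ring), normAdj_eq X q,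
    (X.normAdj_isHermitian q).trace_lucasSeq]
  rfl

end DirGraph

/-! ### Cycle counts as traces of powers. -/

theorem List.card_length_succ {α : Type*} [Fintype α] (P : List α → Prop) (k : ℕ) :
    {l : List α | l.length = k + 1 ∧ P l}.ncard
      = ∑ a, {l : List α | l.length = k ∧ P (a :: l)}.ncard := by
  have hfin : ∀ a, Finite {l : List α | l.length = k ∧ P (a :: l)} := fun a =>
    (List.finite_length_eq α k).subset fun l hl => hl.1
  simp only [← Nat.card_coe_set_eq]
  rw [← Nat.card_sigma]
  refine Nat.card_congr
    { toFun := fun l => match l with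
        | ⟨a :: l, h⟩ => ⟨a, l, by simpa using h.1, h.2⟩
        | ⟨[], h⟩ => absurd h.1 (by simp)
      invFun := fun x => ⟨x.1 :: x.2.1, by simpa using x.2.2.1, x.2.2.2⟩
      left_inv := ?_
      right_inv := fun x => rfl }
  rintro ⟨l, h⟩
  cases l with
  | nil => exact absurd h.1 (by simp)
  | cons a l => rfl

namespace DirGraph

open Matrix

variable {V E : Type*} [Fintype V] [DecidableEq V] [Fintype E]

omit [Fintype V] [Fintype E] in
theorem nbMatrix_apply_of_nbStep [DecidableEq E] {X : DirGraph V E} {a b : E}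
    (h : X.NBStep a b) : X.nbMatrix a b = 1 := if_pos h

omit [Fintype V] [Fintype E] in
theorem nbMatrix_apply_of_not_nbStep [DecidableEq E] {X : DirGraph V E} {a b : E}
    (h : ¬ X.NBStep a b) : X.nbMatrix a b = 0 := if_neg h

omit [Fintype V] in
theorem nbMatrix_pow_apply [DecidableEq E] (X : DirGraph V E) (k : ℕ) (a b : E) :
    (X.nbMatrix ^ (k + 1)) a b
      = {l : List E | l.length = k ∧ List.IsChain X.NBStep (a :: (l ++ [b]))}.ncard := by
  induction k generalizing a with
  | zero =>
    rw [zero_add, pow_one]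
    by_cases h : X.NBStep a b
    · have : {l : List E | l.length = 0 ∧ List.IsChain X.NBStep (a :: (l ++ [b]))} = {[]} := by
        ext l
        simp +contextual [h, List.length_eq_zero_iff]
      rw [this, nbMatrix_apply_of_nbStep h, Set.ncard_singleton, Nat.cast_one]
    · have : {l : List E | l.length = 0 ∧ List.IsChain X.NBStep (a :: (l ++ [b]))} = ∅ := by
        ext l
        simp +contextual [h, List.length_eq_zero_iff]
      rw [this, nbMatrix_apply_of_not_nbStep h, Set.ncard_empty, Nat.cast_zero]
  | succ k ih =>
    rw [List.card_length_succ (fun l => List.IsChain X.NBStep (a :: (l ++ [b]))), pow_succ',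
      Matrix.mul_apply, Nat.cast_sum]
    refine Finset.sum_congr rfl fun c _ => ?_
    rw [ih]
    simp only [List.cons_append, List.isChain_cons_cons]
    by_cases h : X.NBStep a c
    · simp [nbMatrix_apply_of_nbStep h, h]
    · simp [nbMatrix_apply_of_not_nbStep h, h]

omit [Fintype V] in
theorem numCycles_succ_eq_trace [DecidableEq E] (X : DirGraph V E) (k : ℕ) :
    (X.numCycles (k + 1) : ℝ) = (X.nbMatrix ^ (k + 1)).trace := by
  rw [numCycles, List.card_length_succ, Nat.cast_sum, trace]
  refine Finset.sum_congr rfl fun a _ => ?_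
  rw [diag_apply, nbMatrix_pow_apply]
  -- A cyclic chain on `a :: l` is a linear chain on `a :: (l ++ [a])`, which is what the diagonal
  -- entry at `a` counts.
  simp [IsNBCycle]

omit [Fintype V] [DecidableEq V] [Fintype E] in
theorem numCycles_zero (X : DirGraph V E) : X.numCycles 0 = 0 := by
  have : {l : List E | l.length = 0 ∧ X.IsNBCycle l} = ∅ := by
    ext l
    simp +contextual [IsNBCycle, List.length_eq_zero_iff]
  rw [numCycles, this, Set.ncard_empty]

theorem numCycles_le {X : DirGraph V E} {q : ℕ} (hX : X.IsRegular (q + 1)) (k : ℕ) :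
    (X.numCycles k : ℝ) ≤ (q + 1) * Fintype.card V * (q : ℝ) ^ k := by
  classical
  cases k with
  | zero => rw [numCycles_zero, Nat.cast_zero]; positivity
  | succ k => rw [numCycles_succ_eq_trace]; exact trace_nbMatrix_pow_le hX _

/-! ### Primitive cycles against all cycles. -/

omit [Fintype V] [DecidableEq V] in
theorem finite_nbCycles (X : DirGraph V E) (k : ℕ) :
    {l : List E | l.length = k ∧ X.IsNBCycle l}.Finite :=
  (List.finite_length_eq E k).subset fun _ hl => hl.1

omit [Fintype V] [DecidableEq V] in
theorem finite_primitiveCycles (X : DirGraph V E) (k : ℕ) :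
    {l : List E | l.length = k ∧ X.IsPrimitiveCycle l}.Finite :=
  (List.finite_length_eq E k).subset fun _ hl => hl.1

omit [Fintype V] [DecidableEq V] in
theorem numPrimitiveClasses_le_numCycles (X : DirGraph V E) (k : ℕ) :
    X.numPrimitiveClasses k ≤ X.numCycles k :=
  (Set.ncard_image_le (X.finite_primitiveCycles k)).trans
    (Set.ncard_le_ncard (fun _ hl => ⟨hl.1, hl.2.1⟩) (X.finite_nbCycles k))

omit [Fintype V] [DecidableEq V] in
theorem ncard_primitiveCycles_le (X : DirGraph V E) {k : ℕ} (hk : k ≠ 0) :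
    {l : List E | l.length = k ∧ X.IsPrimitiveCycle l}.ncard ≤ k * X.numPrimitiveClasses k := by
  classical
  have hfin := X.finite_primitiveCycles k
  rw [numPrimitiveClasses, Set.ncard_eq_toFinset_card _ hfin,
    Set.ncard_eq_toFinset_card _ (hfin.image _), Set.Finite.toFinset_image]
  refine Finset.card_le_mul_card_image _ _ fun b hb => ?_
  obtain ⟨l, hl, rfl⟩ := Finset.mem_image.mp hb
  have hlk : l.length = k := ((Set.Finite.mem_toFinset _).mp hl).1
  have hne : l ≠ [] := by rintro rfl; exact hk hlk.symm
  refine (Finset.card_le_card (t := l.cyclicPermutations.toFinset) fun l' hl' => ?_).trans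
    ((List.toFinset_card_le _).trans_eq (by rw [List.length_cyclicPermutations_of_ne_nil l hne, hlk]))
  rw [List.mem_toFinset, List.mem_cyclicPermutations_iff]
  exact Cycle.coe_eq_coe.mp (Finset.mem_filter.mp hl').2

omit [Fintype V] [DecidableEq V] in
theorem numCycles_le_add (X : DirGraph V E) {k : ℕ} (hk : k ≠ 0) :
    X.numCycles k ≤ k * X.numPrimitiveClasses k
      + ∑ d ∈ Finset.Icc 1 (k / 2), (k + 1) * X.numCycles d := by
  -- A non-primitive cycle is determined by the length `d` of its root, the root itself and a
  -- rotation amount `r ≤ k`. The exponent `k / d` is at least 2, hence `d ≤ k / 2`.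
  let T : Set (List E) := ⋃ d ∈ Finset.Icc 1 (k / 2), ⋃ r ∈ Finset.range (k + 1),
    (fun l' : List E => (List.replicate (k / d) l').flatten.rotate r) ''
      {l : List E | l.length = d ∧ X.IsNBCycle l}
  have hsub : {l : List E | l.length = k ∧ X.IsNBCycle l}
      ⊆ {l : List E | l.length = k ∧ X.IsPrimitiveCycle l} ∪ T := by
    rintro l ⟨hlk, hl⟩
    by_cases hp : X.IsPrimitiveCycle l
    · exact Or.inl ⟨hlk, hp⟩
    right
    obtain ⟨l', m, hm, hl', hr⟩ : ∃ (l' : List E) (m : ℕ), 2 ≤ m ∧ X.IsNBCycle l' ∧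
        l ~r (List.replicate m l').flatten := by
      by_contra h
      exact hp ⟨hl, h⟩
    obtain ⟨r, hr, hrl⟩ := List.isRotated_iff_mod.mp hr.symm
    have hlen : k = m * l'.length := by
      rw [← hlk, ← hrl]
      simp
    have hpos : 0 < l'.length := List.length_pos_of_ne_nil hl'.1
    have hr' : r ≤ k := by
      rw [hlen]
      simpa using hr
    simp only [T, Set.mem_iUnion]
    refine ⟨l'.length, Finset.mem_Icc.mpr ⟨hpos, ?_⟩, r,
      Finset.mem_range.mpr (Nat.lt_succ_of_le hr'), l', ⟨rfl, hl'⟩, ?_⟩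
    · rw [Nat.le_div_iff_mul_le two_pos, hlen, mul_comm]
      exact Nat.mul_le_mul_right _ hm
    · beta_reduce
      rw [hlen, Nat.mul_div_cancel _ hpos, hrl]
  have hT : T.ncard ≤ ∑ d ∈ Finset.Icc 1 (k / 2), (k + 1) * X.numCycles d := by
    refine (Finset.set_ncard_biUnion_le _ _).trans (Finset.sum_le_sum fun d _ => ?_)
    refine (Finset.set_ncard_biUnion_le _ _).trans ?_
    refine (Finset.sum_le_card_nsmul _ _ (X.numCycles d) fun r _ =>
      Set.ncard_image_le (X.finite_nbCycles d)).trans_eq ?_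
    simp
  have hTfin : T.Finite :=
    Set.Finite.biUnion (Finset.finite_toSet _) fun d _ =>
      Set.Finite.biUnion (Finset.finite_toSet _) fun r _ => (X.finite_nbCycles d).image _
  refine (Set.ncard_le_ncard hsub ((X.finite_primitiveCycles k).union hTfin)).trans ?_
  exact (Set.ncard_union_le _ _).trans (add_le_add (X.ncard_primitiveCycles_le hk) hT)

/-- The cycles that are not primitive contribute at most `n * q ^ (k / 2)`, up to a factor which is
polynomial in `k`. -/
theorem numCycles_two_mul_le {X : DirGraph V E} {q : ℕ} (hq : 1 ≤ q) (hX : X.IsRegular (q + 1))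
    (j : ℕ) :
    (X.numCycles (2 * j) : ℝ) ≤ 2 * j * X.numPrimitiveClasses (2 * j)
      + j * (2 * j + 1) * ((q + 1) * Fintype.card V * (q : ℝ) ^ j) := by
  rcases Nat.eq_zero_or_pos j with rfl | hj
  · simp [numCycles_zero]
  have h := X.numCycles_le_add (k := 2 * j) (by omega)
  rw [Nat.mul_div_cancel_left _ two_pos] at h
  have h' : (X.numCycles (2 * j) : ℝ) ≤ 2 * j * X.numPrimitiveClasses (2 * j)
      + ∑ d ∈ Finset.Icc 1 j, (2 * j + 1) * (X.numCycles d : ℝ) := by exact_mod_cast h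
  refine h'.trans (add_le_add_right ?_ _)
  have hq' : (1 : ℝ) ≤ q := by exact_mod_cast hq
  refine (Finset.sum_le_card_nsmul _ _
    ((2 * j + 1) * ((q + 1) * Fintype.card V * (q : ℝ) ^ j)) fun d hd => ?_).trans_eq ?_
  · refine mul_le_mul_of_nonneg_left ((numCycles_le hX d).trans ?_) (by positivity)
    exact mul_le_mul_of_nonneg_left (pow_le_pow_right₀ hq' (Finset.mem_Icc.mp hd).2) (by positivity)
  · rw [nsmul_eq_mul, Nat.card_Icc, Nat.add_sub_cancel]
    ring

end DirGraph

/-! ### Size of the Lucas sequence at an eigenvalue. -/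

theorem lucasSeq_neg {R : Type*} [CommRing R] (q : ℕ) (μ : R) (k : ℕ) :
    lucasSeq q (-μ) k = (-1) ^ k * lucasSeq q μ k := by
  induction k using Nat.twoStepInduction with
  | zero => simp [lucasSeq]
  | one => simp [lucasSeq]
  | more k h1 h2 => rw [lucasSeq, lucasSeq, h1, h2]; ring

theorem lucasSeq_two_mul_abs (q : ℕ) (μ : ℝ) (j : ℕ) :
    lucasSeq q |μ| (2 * j) = lucasSeq q μ (2 * j) := by
  rcases abs_choice μ with h | h <;> simp [h, lucasSeq_neg]

theorem lucasSeq_add {R : Type*} [CommRing R] {q : ℕ} {α β : R} (h : α * β = q) (k : ℕ) :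
    lucasSeq q (α + β) k = α ^ k + β ^ k := by
  induction k using Nat.twoStepInduction with
  | zero => simp [lucasSeq]; norm_num
  | one => simp [lucasSeq]
  | more k h1 h2 => rw [lucasSeq, h1, h2, ← h]; ring

/-- The tempered case `α = √q e^{iθ}`, `β = √q e^{-iθ}`, in real form. -/
theorem lucasSeq_cos (q : ℕ) (θ : ℝ) (k : ℕ) :
    lucasSeq q (2 * √q * Real.cos θ) k = 2 * √q ^ k * Real.cos (k * θ) := by
  have hq : √(q : ℝ) ^ 2 = q := Real.sq_sqrt (Nat.cast_nonneg q)
  induction k using Nat.twoStepInduction with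
  | zero => simp [lucasSeq]
  | one => simp [lucasSeq]
  | more k h1 h2 =>
    have e1 : ((k + 2 : ℕ) : ℝ) * θ = (k + 1) * θ + θ := by push_cast; ring
    have e2 : (k : ℝ) * θ = (k + 1) * θ - θ := by ring
    rw [lucasSeq, h1, h2, e1, e2, Real.cos_add, Real.cos_sub]
    push_cast
    linear_combination (2 * √(q : ℝ) ^ k * (Real.cos ((k + 1) * θ) * Real.cos θ
      + Real.sin ((k + 1) * θ) * Real.sin θ)) * hq

theorem abs_lucasSeq_le {q : ℕ} {μ : ℝ} (hμ : |μ| ≤ 2 * √q) (j : ℕ) :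
    |lucasSeq q μ (2 * j)| ≤ 2 * (q : ℝ) ^ j := by
  obtain ⟨θ, rfl⟩ : ∃ θ, μ = 2 * √q * Real.cos θ := by
    rcases (Real.sqrt_nonneg (q : ℝ)).eq_or_lt with h0 | h0
    · rw [← h0, mul_zero] at hμ
      exact ⟨0, by rw [← h0]; simpa using hμ⟩
    · have := abs_le.mp hμ
      refine ⟨Real.arccos (μ / (2 * √q)), ?_⟩
      rw [Real.cos_arccos, mul_div_cancel₀]
      · positivity
      · rw [le_div_iff₀ (by positivity)]; linarith
      · rw [div_le_iff₀ (by positivity)]; linarith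
  rw [lucasSeq_cos, pow_mul, Real.sq_sqrt (Nat.cast_nonneg q), abs_mul,
    abs_of_nonneg (by positivity : (0 : ℝ) ≤ 2 * (q : ℝ) ^ j)]
  exact mul_le_of_le_one_right (by positivity) (Real.abs_cos_le_one _)

/-- `1 - 2 / p`, where `p` is the `p`-value of `lam`. -/
noncomputable def spectralExponent (q : ℕ) (lam : ℝ) : ℝ := 1 - 2 * ((pValue q lam)⁻¹).toReal

section

variable {q : ℕ} {lam : ℝ}

theorem pValue_of_le (h : |lam| ≤ 2 / ((q : ℝ) + 1) * √q) : pValue q lam = 2 := by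
  rw [pValue, if_pos h]

theorem pValue_of_lt (hq : 2 ≤ q) (h : 2 / ((q : ℝ) + 1) * √q < |lam|) (h1 : |lam| ≤ 1) :
    2 < pValue q lam ∧ |lam| = 1 / ((q : ℝ) + 1) *
      ((q : ℝ) ^ ((pValue q lam)⁻¹).toReal + (q : ℝ) ^ (1 - ((pValue q lam)⁻¹).toReal)) := by
  obtain ⟨p, hp, hu⟩ := existsUnique_pValue q hq lam h h1
  have : pValue q lam = p := by
    have hs : {p : ℝ≥0∞ | 2 < p ∧ |lam| = 1 / ((q : ℝ) + 1) *
        ((q : ℝ) ^ (p⁻¹).toReal + (q : ℝ) ^ (1 - (p⁻¹).toReal))} = {p} :=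
      Set.eq_singleton_iff_unique_mem.mpr ⟨hp, hu⟩
    rw [pValue, if_neg h.not_ge, hs, sSup_singleton]
  rwa [this]

theorem two_le_pValue (hq : 2 ≤ q) (h1 : |lam| ≤ 1) : 2 ≤ pValue q lam := by
  rcases le_or_gt |lam| (2 / ((q : ℝ) + 1) * √q) with h | h
  · rw [pValue_of_le h]
  · exact (pValue_of_lt hq h h1).1.le

theorem toReal_inv_pValue_le (hq : 2 ≤ q) (h1 : |lam| ≤ 1) :
    ((pValue q lam)⁻¹).toReal ≤ 1 / 2 := by
  have := ENNReal.toReal_mono (by simp) (ENNReal.inv_le_inv.mpr (two_le_pValue hq h1))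
  simpa using this

theorem spectralExponent_nonneg (hq : 2 ≤ q) (h1 : |lam| ≤ 1) : 0 ≤ spectralExponent q lam := by
  have := toReal_inv_pValue_le hq h1
  rw [spectralExponent]
  linarith

theorem spectralExponent_le_one (q : ℕ) (lam : ℝ) : spectralExponent q lam ≤ 1 := by
  have : 0 ≤ ((pValue q lam)⁻¹).toReal := ENNReal.toReal_nonneg
  rw [spectralExponent]
  linarith

theorem ofReal_le_pValue_iff (hq : 2 ≤ q) (h1 : |lam| ≤ 1) {p : ℝ} (hp : 0 < p) :
    ENNReal.ofReal p ≤ pValue q lam ↔ 1 - 2 / p ≤ spectralExponent q lam := by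
  have hne : (pValue q lam)⁻¹ ≠ ⊤ :=
    ENNReal.inv_ne_top.mpr (lt_of_lt_of_le two_pos (two_le_pValue hq h1)).ne'
  rw [← ENNReal.inv_le_inv, ← ENNReal.ofReal_inv_of_pos hp,
    ENNReal.le_ofReal_iff_toReal_le hne (by positivity), spectralExponent, div_eq_mul_inv]
  constructor <;> intro h <;> linarith

theorem lucasSeq_eq_of_lt (hq : 2 ≤ q) (h : 2 / ((q : ℝ) + 1) * √q < |lam|) (h1 : |lam| ≤ 1)
    (j : ℕ) :
    lucasSeq q (((q : ℝ) + 1) * lam) (2 * j)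
      = (q : ℝ) ^ j * (q : ℝ) ^ (-(j * spectralExponent q lam))
        + (q : ℝ) ^ j * (q : ℝ) ^ (j * spectralExponent q lam) := by
  have hq0 : (0 : ℝ) < q := by positivity
  have hpos : (0 : ℝ) < (q : ℝ) + 1 := by positivity
  obtain ⟨-, hl⟩ := pValue_of_lt hq h h1
  set u := ((pValue q lam)⁻¹).toReal with hu
  have hμ : |((q : ℝ) + 1) * lam| = (q : ℝ) ^ u + (q : ℝ) ^ (1 - u) := by
    rw [abs_mul, abs_of_pos hpos, hl]
    field_simp
  have ht : spectralExponent q lam = 1 - 2 * u := rfl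
  rw [← lucasSeq_two_mul_abs, hμ, lucasSeq_add, ← Real.rpow_natCast, ← Real.rpow_natCast,
    ← Real.rpow_natCast, ← Real.rpow_mul hq0.le, ← Real.rpow_mul hq0.le, ← Real.rpow_add hq0,
    ← Real.rpow_add hq0, ht]
  · push_cast
    congr 2 <;> ring
  · rw [← Real.rpow_add hq0]
    simp

theorem lucasSeq_le (hq : 2 ≤ q) (h1 : |lam| ≤ 1) (j : ℕ) :
    lucasSeq q (((q : ℝ) + 1) * lam) (2 * j)
      ≤ (q : ℝ) ^ j * (2 * (q : ℝ) ^ (j * spectralExponent q lam)) := by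
  have hq1 : (1 : ℝ) ≤ q := by exact_mod_cast (by omega : 1 ≤ q)
  have hpos : (0 : ℝ) < (q : ℝ) + 1 := by positivity
  have ht := mul_nonneg (Nat.cast_nonneg (α := ℝ) j) (spectralExponent_nonneg hq h1)
  have hge := Real.one_le_rpow hq1 ht
  have hqj : (0 : ℝ) ≤ (q : ℝ) ^ j := by positivity
  rcases le_or_gt |lam| (2 / ((q : ℝ) + 1) * √q) with h | h
  · have hμ : |((q : ℝ) + 1) * lam| ≤ 2 * √q := by
      rw [abs_mul, abs_of_pos hpos]
      refine (mul_le_mul_of_nonneg_left h hpos.le).trans_eq ?_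
      field_simp
    have := (abs_le.mp (abs_lucasSeq_le hμ j)).2
    nlinarith
  · have hle := Real.rpow_le_one_of_one_le_of_nonpos hq1 (neg_nonpos.mpr ht)
    rw [lucasSeq_eq_of_lt hq h h1]
    nlinarith

/-- In the tempered range the exponent is 0 and the sequence may be as low as `-2 q ^ j`; together
with the `q ^ j` on the left this gives the 3. -/
theorem le_lucasSeq (hq : 2 ≤ q) (h1 : |lam| ≤ 1) (j : ℕ) :
    (q : ℝ) ^ j * (q : ℝ) ^ (j * spectralExponent q lam)
      ≤ lucasSeq q (((q : ℝ) + 1) * lam) (2 * j) + 3 * (q : ℝ) ^ j := by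
  have hpos : (0 : ℝ) < (q : ℝ) + 1 := by positivity
  rcases le_or_gt |lam| (2 / ((q : ℝ) + 1) * √q) with h | h
  · have hμ : |((q : ℝ) + 1) * lam| ≤ 2 * √q := by
      rw [abs_mul, abs_of_pos hpos]
      refine (mul_le_mul_of_nonneg_left h hpos.le).trans_eq ?_
      field_simp
    have := (abs_le.mp (abs_lucasSeq_le hμ j)).1
    have ht : spectralExponent q lam = 0 := by
      rw [spectralExponent, pValue_of_le h]
      simp
    rw [ht, mul_zero, Real.rpow_zero]
    linarith
  · rw [lucasSeq_eq_of_lt hq h h1]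
    have : (0 : ℝ) ≤ (q : ℝ) ^ j * (q : ℝ) ^ (-(j * spectralExponent q lam)) := by positivity
    have : (0 : ℝ) ≤ (q : ℝ) ^ j := by positivity
    linarith

end

/-! ### Cycle counts and the spectral sum. -/

namespace DirGraph

variable {V E : Type*} [Fintype V] [DecidableEq V] [Fintype E]

/-- Maximum principle: read the eigenvalue equation at a vertex where the eigenvector is largest in
absolute value. -/
theorem abs_adjEigenvalues_le_one {X : DirGraph V E} {q : ℕ} (hX : X.IsRegular (q + 1)) (i : V) :
    |X.adjEigenvalues q i| ≤ 1 := by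
  classical
  have hM := X.normAdj_isHermitian q
  set f : V → ℝ := (hM.eigenvectorBasis i).ofLp with hf
  have hfe : (X.normAdj q).mulVec f = X.adjEigenvalues q i • f := hM.mulVec_eigenvectorBasis i
  have hf0 : f ≠ 0 := fun h => hM.eigenvectorBasis.orthonormal.ne_zero i (by
    ext x
    exact congrFun h x)
  obtain ⟨x, -, hx⟩ := Finset.exists_max_image Finset.univ (fun x => |f x|) ⟨i, Finset.mem_univ i⟩
  have hfx : 0 < |f x| := by
    obtain ⟨y, hy⟩ := Function.ne_iff.mp hf0
    exact (abs_pos.mpr hy).trans_le (hx y (Finset.mem_univ y))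
  have h := congrFun hfe x
  rw [normAdj_mulVec, Pi.smul_apply, smul_eq_mul] at h
  have hpos : (0 : ℝ) < (q : ℝ) + 1 := by positivity
  have hsum : |∑ e : E with X.origin e = x, f (X.terminus e)| ≤ (q + 1) * |f x| := by
    refine (Finset.abs_sum_le_sum_abs _ _).trans ?_
    refine (Finset.sum_le_card_nsmul _ _ _ fun e _ => hx _ (Finset.mem_univ _)).trans_eq ?_
    rw [card_filter_origin hX, nsmul_eq_mul]
    push_cast
    rfl
  refine le_of_mul_le_mul_right ?_ hfx
  rw [← abs_mul, ← h, abs_mul, abs_of_pos (one_div_pos.mpr hpos), one_div, inv_mul_le_iff₀ hpos,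
    one_mul]
  exact hsum

/-- The sum over the spectrum which both the number of non-backtracking cycles of length `2 * j`
and the density property control. -/
noncomputable def spectralSum (X : DirGraph V E) (q : ℕ) (b : ℝ) : ℝ :=
  ∑ i, b ^ spectralExponent q (X.adjEigenvalues q i)

variable {X : DirGraph V E} {q : ℕ}

theorem numCycles_eq_sum (hX : X.IsRegular (q + 1)) {j : ℕ} (hj : j ≠ 0) :
    (X.numCycles (2 * j) : ℝ)
      = ∑ i, lucasSeq q (((q : ℝ) + 1) * X.adjEigenvalues q i) (2 * j)
        + (q - 1) * Fintype.card V := by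
  classical
  obtain ⟨j, rfl⟩ := Nat.exists_eq_succ_of_ne_zero hj
  rw [show 2 * j.succ = 2 * j + 1 + 1 by rw [Nat.succ_eq_add_one]; ring, numCycles_succ_eq_trace]
  exact trace_nbMatrix_pow hX j

theorem numCycles_le_spectralSum (hq : 2 ≤ q) (hX : X.IsRegular (q + 1)) (j : ℕ) :
    (X.numCycles (2 * j) : ℝ)
      ≤ (q : ℝ) ^ j * (2 * X.spectralSum q ((q : ℝ) ^ j) + (q - 1) * Fintype.card V) := by
  have hq1 : (1 : ℝ) ≤ q := by exact_mod_cast (by omega : 1 ≤ q)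
  have hn : (0 : ℝ) ≤ (q - 1) * Fintype.card V :=
    mul_nonneg (by linarith) (Nat.cast_nonneg _)
  have hs : ∀ t : ℝ, (q : ℝ) ^ ((j : ℝ) * t) = ((q : ℝ) ^ j) ^ t := fun t => by
    rw [Real.rpow_mul (by positivity), Real.rpow_natCast]
  rcases eq_or_ne j 0 with rfl | hj
  · have : 0 ≤ X.spectralSum q ((q : ℝ) ^ 0) := Finset.sum_nonneg fun i _ => by positivity
    rw [mul_zero, numCycles_zero, Nat.cast_zero]
    positivity
  · rw [numCycles_eq_sum hX hj, mul_add, spectralSum, Finset.mul_sum, Finset.mul_sum]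
    refine add_le_add (Finset.sum_le_sum fun i _ => ?_)
      (le_mul_of_one_le_left hn (one_le_pow₀ hq1))
    rw [← hs]
    exact lucasSeq_le hq (abs_adjEigenvalues_le_one hX i) j

theorem spectralSum_le_numCycles (hq : 2 ≤ q) (hX : X.IsRegular (q + 1)) (j : ℕ) :
    (q : ℝ) ^ j * X.spectralSum q ((q : ℝ) ^ j)
      ≤ X.numCycles (2 * j) + 3 * (q : ℝ) ^ j * Fintype.card V := by
  have hq1 : (1 : ℝ) ≤ q := by exact_mod_cast (by omega : 1 ≤ q)
  have hs : ∀ t : ℝ, (q : ℝ) ^ ((j : ℝ) * t) = ((q : ℝ) ^ j) ^ t := fun t => by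
    rw [Real.rpow_mul (by positivity), Real.rpow_natCast]
  -- Length 0 is separate: the count is 0 by convention and is not `tr B ^ 0`.
  rcases eq_or_ne j 0 with rfl | hj
  · simp [spectralSum, numCycles_zero]
    linarith [Nat.cast_nonneg (α := ℝ) (Fintype.card V)]
  · have hn : (0 : ℝ) ≤ (q - 1) * Fintype.card V :=
      mul_nonneg (by linarith) (Nat.cast_nonneg _)
    rw [numCycles_eq_sum hX hj, spectralSum, Finset.mul_sum]
    have : ∑ i, (q : ℝ) ^ j * ((q : ℝ) ^ j) ^ spectralExponent q (X.adjEigenvalues q i)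
        ≤ ∑ i, (lucasSeq q (((q : ℝ) + 1) * X.adjEigenvalues q i) (2 * j) + 3 * (q : ℝ) ^ j) := by
      refine Finset.sum_le_sum fun i _ => ?_
      rw [← hs]
      exact le_lucasSeq hq (abs_adjEigenvalues_le_one hX i) j
    rw [Finset.sum_add_distrib, Finset.sum_const, nsmul_eq_mul, Finset.card_univ] at this
    linarith

end DirGraph

/-! ### Slicing the unit interval, and rounding of the cycle length. -/

theorem exists_nat_div_le_le {M : ℕ} (hM : 0 < M) {t : ℝ} (h0 : 0 ≤ t) (h1 : t ≤ 1) :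
    ∃ h < M, (h : ℝ) / M ≤ t ∧ t ≤ (h + 1) / M := by
  have hM' : (0 : ℝ) < M := by exact_mod_cast hM
  rcases h1.eq_or_lt with rfl | h1
  · refine ⟨M - 1, by omega, ?_, ?_⟩
    · rw [div_le_one hM']
      exact_mod_cast Nat.sub_le M 1
    · rw [Nat.cast_sub hM, Nat.cast_one, sub_add_cancel, div_self hM'.ne']
  · refine ⟨⌊M * t⌋₊, ?_, ?_, ?_⟩
    · rw [Nat.floor_lt (by positivity)]
      nlinarith
    · rw [div_le_iff₀ hM', mul_comm t]
      exact Nat.floor_le (by positivity)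
    · rw [le_div_iff₀ hM', mul_comm t]
      exact (Nat.lt_floor_add_one _).le

section Floor

variable {q : ℕ} {A n : ℝ}

theorem pow_floor_logb_le (hq : 2 ≤ q) (hA : 0 ≤ A) (hn : 1 ≤ n) :
    (q : ℝ) ^ ⌊A * Real.logb q n⌋₊ ≤ n ^ A := by
  have hq1 : (1 : ℝ) < q := by exact_mod_cast hq
  have hl : 0 ≤ A * Real.logb q n := mul_nonneg hA (Real.logb_nonneg hq1 hn)
  rw [← Real.rpow_natCast]
  refine (Real.rpow_le_rpow_of_exponent_le hq1.le (Nat.floor_le hl)).trans_eq ?_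
  rw [mul_comm, Real.rpow_mul (by linarith), Real.rpow_logb (by linarith) hq1.ne' (by linarith)]

theorem rpow_le_mul_pow_floor_logb (hq : 2 ≤ q) (hn : 1 ≤ n) :
    n ^ A ≤ q * (q : ℝ) ^ ⌊A * Real.logb q n⌋₊ := by
  have hq1 : (1 : ℝ) < q := by exact_mod_cast hq
  have h : n ^ A = (q : ℝ) ^ (A * Real.logb q n) := by
    rw [mul_comm, Real.rpow_mul (by linarith), Real.rpow_logb (by linarith) hq1.ne' (by linarith)]
  rw [h, ← pow_succ', ← Real.rpow_natCast]
  refine Real.rpow_le_rpow_of_exponent_le hq1.le ?_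
  push_cast
  exact (Nat.lt_floor_add_one _).le

theorem floor_logb_le (hq : 2 ≤ q) (hA0 : 0 ≤ A) (hA1 : A ≤ 1) (hn : 1 ≤ n) {δ : ℝ} (hδ : 0 < δ) :
    (⌊A * Real.logb q n⌋₊ : ℝ) ≤ (δ * Real.log q)⁻¹ * n ^ δ := by
  have hq1 : (1 : ℝ) < q := by exact_mod_cast hq
  have hl : 0 ≤ Real.logb q n := Real.logb_nonneg hq1 hn
  calc (⌊A * Real.logb q n⌋₊ : ℝ) ≤ A * Real.logb q n := Nat.floor_le (mul_nonneg hA0 hl)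
    _ ≤ Real.log n / Real.log q := mul_le_of_le_one_left hl hA1
    _ ≤ n ^ δ / δ / Real.log q :=
      div_le_div_of_nonneg_right (Real.log_le_rpow_div (by linarith) hδ) (Real.log_nonneg hq1.le)
    _ = _ := by rw [div_div, div_eq_inv_mul]

end Floor

/-! ### The spectral sum against the density property and the cycle counts. -/

namespace DirGraph

section SpectralSum

variable {V E : Type*} [Fintype V] [DecidableEq V] [Fintype E] {X : DirGraph V E} {q : ℕ}

theorem spectralSum_mono (hq : 2 ≤ q) (hX : X.IsRegular (q + 1)) {b b' : ℝ} (hb : 0 ≤ b)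
    (h : b ≤ b') : X.spectralSum q b ≤ X.spectralSum q b' :=
  Finset.sum_le_sum fun i _ =>
    Real.rpow_le_rpow hb h (spectralExponent_nonneg hq (abs_adjEigenvalues_le_one hX i))

omit [Fintype E] in
-- Exponents are at most 1, so a factor `q` in the base costs at most a factor `q`. This absorbs the
-- floor in the cycle length.
theorem spectralSum_mul_le (X : DirGraph V E) (hq : 2 ≤ q) {b : ℝ} (hb : 0 ≤ b) :
    X.spectralSum q (q * b) ≤ q * X.spectralSum q b := by
  have hq1 : (1 : ℝ) ≤ q := by exact_mod_cast (by omega : 1 ≤ q)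
  rw [spectralSum, spectralSum, Finset.mul_sum]
  refine Finset.sum_le_sum fun i _ => ?_
  rw [Real.mul_rpow (by positivity) hb]
  refine mul_le_mul_of_nonneg_right ?_ (by positivity)
  exact (Real.rpow_le_rpow_of_exponent_le hq1 (spectralExponent_le_one q _)).trans_eq
    (Real.rpow_one _)

omit [Fintype E] in
theorem ncard_mul_rpow_le_spectralSum (X : DirGraph V E) (q : ℕ) {b : ℝ} (hb : 1 ≤ b) (s : ℝ) :
    ({v | s ≤ spectralExponent q (X.adjEigenvalues q v)}.ncard : ℝ) * b ^ s
      ≤ X.spectralSum q b := by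
  classical
  have hc : {v | s ≤ spectralExponent q (X.adjEigenvalues q v)}.ncard
      = ({v | s ≤ spectralExponent q (X.adjEigenvalues q v)} : Finset V).card := by
    rw [← Set.ncard_coe_finset]
    simp
  rw [hc, ← nsmul_eq_mul]
  refine (Finset.card_nsmul_le_sum _ (fun v => b ^ spectralExponent q (X.adjEigenvalues q v)) _
    fun v hv => Real.rpow_le_rpow_of_exponent_le hb (Finset.mem_filter.mp hv).2).trans ?_
  exact Finset.sum_le_sum_of_subset_of_nonneg (Finset.filter_subset _ _) fun v _ _ => by positivity

theorem spectralSum_le_sum_ncard (hq : 2 ≤ q) (hX : X.IsRegular (q + 1)) {M : ℕ} (hM : 0 < M)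
    {b : ℝ} (hb : 1 ≤ b) :
    X.spectralSum q b ≤ ∑ h ∈ Finset.range M,
      ({v | (h : ℝ) / M ≤ spectralExponent q (X.adjEigenvalues q v)}.ncard : ℝ)
        * b ^ ((h + 1 : ℝ) / M) := by
  classical
  have hc : ∀ s : ℝ, ({v | s ≤ spectralExponent q (X.adjEigenvalues q v)}.ncard : ℝ)
      = ∑ v, if s ≤ spectralExponent q (X.adjEigenvalues q v) then 1 else 0 := fun s => by
    rw [Finset.sum_boole, ← Set.ncard_coe_finset]
    simp
  simp only [hc, Finset.sum_mul]
  rw [Finset.sum_comm]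
  refine Finset.sum_le_sum fun v _ => ?_
  obtain ⟨h, hhM, h1, h2⟩ := exists_nat_div_le_le hM
    (spectralExponent_nonneg hq (abs_adjEigenvalues_le_one hX v)) (spectralExponent_le_one q _)
  refine (Real.rpow_le_rpow_of_exponent_le hb h2).trans ?_
  have := Finset.single_le_sum (f := fun h : ℕ =>
    (if (h : ℝ) / M ≤ spectralExponent q (X.adjEigenvalues q v) then (1 : ℝ) else 0)
      * b ^ ((h + 1 : ℝ) / M)) (fun h _ => by positivity) (Finset.mem_range.mpr hhM)
  simpa only [if_pos h1, one_mul] using this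

end SpectralSum

section Family

variable {ι : Type*} {V E : ι → Type*} [∀ i, Fintype (V i)] [∀ i, DecidableEq (V i)]
  [∀ i, Nonempty (V i)] [∀ i, Fintype (E i)] {q : ℕ} {X : ∀ i, DirGraph (V i) (E i)} {A : ℝ}

theorem one_le_card (W : Type*) [Fintype W] [Nonempty W] : (1 : ℝ) ≤ Fintype.card W := by
  exact_mod_cast Fintype.card_pos

omit [∀ i, Nonempty (V i)] in
-- The substitution `s = 1 - 2 / p` maps `(2, ∞)` onto `(0, 1)`.
theorem sarnakXueDensity_iff_ncard (hq : 2 ≤ q) (hX : ∀ i, (X i).IsRegular (q + 1)) :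
    SarnakXueDensity X q A ↔ ∀ ε : ℝ, 0 < ε → ∃ C : ℝ, ∀ s : ℝ, 0 < s → s < 1 → ∀ i,
      ({v | s ≤ spectralExponent q ((X i).adjEigenvalues q v)}.ncard : ℝ)
        ≤ C * (Fintype.card (V i) : ℝ) ^ (1 - A * s + ε) := by
  refine forall₂_congr fun ε _ => exists_congr fun C => ?_
  have key : ∀ p : ℝ, 2 < p → ∀ i,
      {v | ENNReal.ofReal p ≤ pValue q ((X i).adjEigenvalues q v)}
        = {v | 1 - 2 / p ≤ spectralExponent q ((X i).adjEigenvalues q v)} := fun p hp i =>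
    Set.ext fun v => ofReal_le_pValue_iff hq (abs_adjEigenvalues_le_one (hX i) v) (by linarith)
  constructor
  · intro h s hs0 hs1 i
    have hp : 2 < 2 / (1 - s) := by
      rw [lt_div_iff₀ (by linarith)]
      linarith
    have hps : 1 - 2 / (2 / (1 - s)) = s := by
      have : 1 - s ≠ 0 := by linarith
      field_simp
      ring
    have := h _ hp i
    rwa [key _ hp, hps] at this
  · intro h p hp i
    rw [key p hp]
    have : 2 / p < 1 := by rwa [div_lt_one (by linarith)]
    have : 0 < 2 / p := div_pos two_pos (by linarith)
    exact h _ (by linarith) (by linarith) i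

theorem sarnakXueDensity_iff_spectralSum (hq : 2 ≤ q) (hX : ∀ i, (X i).IsRegular (q + 1))
    (hA0 : 0 ≤ A) (hA1 : A ≤ 1) :
    SarnakXueDensity X q A ↔ ∀ ε : ℝ, 0 < ε → ∃ C : ℝ, ∀ i,
      (X i).spectralSum q ((Fintype.card (V i) : ℝ) ^ A)
        ≤ C * (Fintype.card (V i) : ℝ) ^ (1 + ε) := by
  rw [sarnakXueDensity_iff_ncard hq hX]
  constructor
  · intro H ε hε
    -- Rounding exponents up to multiples of `1 / M` costs `n ^ (A / M) ≤ n ^ (ε / 2)`; the density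
    -- property uses the other `ε / 2`.
    obtain ⟨M, hM0, hM⟩ : ∃ M : ℕ, 0 < M ∧ (1 : ℝ) / M ≤ ε / 2 := by
      obtain ⟨M, hM⟩ := exists_nat_one_div_lt (half_pos hε)
      exact ⟨M + 1, M.succ_pos, by push_cast; exact hM.le⟩
    obtain ⟨C, hC⟩ := H (ε / 2) (half_pos hε)
    refine ⟨M * max C 1, fun i => ?_⟩
    set n := (Fintype.card (V i) : ℝ) with hn
    have hn1 : 1 ≤ n := one_le_card (V i)
    have hn0 : 0 < n := by linarith
    refine (spectralSum_le_sum_ncard hq (hX i) hM0 (Real.one_le_rpow hn1 hA0)).trans ?_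
    refine (Finset.sum_le_card_nsmul _ _ (max C 1 * n ^ (1 + ε)) fun h hh => ?_).trans_eq ?_
    · have hcount : ({v | (h : ℝ) / M ≤ spectralExponent q ((X i).adjEigenvalues q v)}.ncard : ℝ)
          ≤ max C 1 * n ^ (1 - A * (h / M) + ε / 2) := by
        -- The slice starting at 0 lies outside the density property; it contains at most `n`
        -- eigenvalues, whence `max C 1`.
        rcases Nat.eq_zero_or_pos h with rfl | hpos
        · have h1 : ({v | ((0 : ℕ) : ℝ) / M
              ≤ spectralExponent q ((X i).adjEigenvalues q v)}.ncard : ℝ) ≤ n := by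
            rw [hn, ← Nat.card_eq_fintype_card]
            exact_mod_cast Set.ncard_le_card _
          have h2 : n ≤ n ^ (1 - A * (((0 : ℕ) : ℝ) / M) + ε / 2) := by
            simpa using Real.rpow_le_rpow_of_exponent_le hn1
              (by simp; linarith : (1 : ℝ) ≤ 1 - A * (((0 : ℕ) : ℝ) / M) + ε / 2)
          exact h1.trans (h2.trans (le_mul_of_one_le_left (by positivity) (le_max_right _ _)))
        · have hM' : (0 : ℝ) < M := by exact_mod_cast hM0
          have hlt : (h : ℝ) / M < 1 := by
            rw [div_lt_one hM']
            exact_mod_cast Finset.mem_range.mp hh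
          refine (hC _ (by positivity) hlt i).trans ?_
          exact mul_le_mul_of_nonneg_right (le_max_left _ _) (by positivity)
      refine (mul_le_mul_of_nonneg_right hcount (by positivity)).trans ?_
      rw [mul_assoc, ← Real.rpow_mul hn0.le, ← Real.rpow_add hn0]
      refine mul_le_mul_of_nonneg_left (Real.rpow_le_rpow_of_exponent_le hn1 ?_) (by positivity)
      have e : 1 - A * (h / M) + ε / 2 + A * ((h + 1) / M) = 1 + ε / 2 + A * (1 / M) := by ring
      have : A * (1 / M) ≤ 1 / M := mul_le_of_le_one_left (by positivity) hA1
      linarith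
    · rw [Finset.card_range, nsmul_eq_mul, mul_assoc]
  · intro H ε hε
    obtain ⟨C, hC⟩ := H ε hε
    refine ⟨C, fun s _ _ i => ?_⟩
    have hn1 := one_le_card (V i)
    have hn0 : (0 : ℝ) < Fintype.card (V i) := by linarith
    have h := (ncard_mul_rpow_le_spectralSum (X i) q (Real.one_le_rpow hn1 hA0) s).trans (hC i)
    rw [← Real.rpow_mul hn0.le, ← le_div_iff₀ (by positivity), mul_div_assoc,
      ← Real.rpow_sub hn0] at h
    rwa [show 1 - A * s + ε = 1 + ε - A * s by ring]

theorem spectralSum_iff_numCycles (hq : 2 ≤ q) (hX : ∀ i, (X i).IsRegular (q + 1)) (hA : 0 ≤ A) :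
    (∀ ε : ℝ, 0 < ε → ∃ C : ℝ, ∀ i, (X i).spectralSum q ((Fintype.card (V i) : ℝ) ^ A)
        ≤ C * (Fintype.card (V i) : ℝ) ^ (1 + ε)) ↔
      ∀ ε : ℝ, 0 < ε → ∃ C : ℝ, ∀ i,
        ((X i).numCycles (cycleLength q A (Fintype.card (V i))) : ℝ)
          ≤ C * (Fintype.card (V i) : ℝ) ^ (1 + ε)
            * (q : ℝ) ^ ⌊A * Real.logb q (Fintype.card (V i))⌋₊ := by
  have hq1 : (1 : ℝ) ≤ q := by exact_mod_cast (by omega : 1 ≤ q)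
  have hle : ∀ i {ε : ℝ}, 0 < ε →
      (Fintype.card (V i) : ℝ) ≤ (Fintype.card (V i) : ℝ) ^ (1 + ε) := fun i ε hε => by
    simpa using Real.rpow_le_rpow_of_exponent_le (one_le_card (V i))
      (by linarith : (1 : ℝ) ≤ 1 + ε)
  refine forall₂_congr fun ε hε => ⟨?_, ?_⟩
  · rintro ⟨C, hC⟩
    refine ⟨2 * C + (q - 1), fun i => (numCycles_le_spectralSum hq (hX i) _).trans ?_⟩
    rw [mul_comm]
    refine mul_le_mul_of_nonneg_right ?_ (by positivity)
    have h1 := (spectralSum_mono hq (hX i) (by positivity)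
      (pow_floor_logb_le hq hA (one_le_card (V i)))).trans (hC i)
    have h2 := mul_le_mul_of_nonneg_left (hle i hε) (sub_nonneg.mpr hq1)
    linarith
  · rintro ⟨C, hC⟩
    -- The factor `q` pays for `n ^ A ≤ q * q ^ j`, and the 3 is the tempered loss.
    refine ⟨q * (C + 3), fun i => ?_⟩
    have h1 := spectralSum_mono hq (hX i) (by positivity)
      (rpow_le_mul_pow_floor_logb (A := A) hq (one_le_card (V i)))
    have h2 := spectralSum_mul_le (X i) hq
      (b := (q : ℝ) ^ ⌊A * Real.logb q (Fintype.card (V i))⌋₊) (by positivity)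
    refine h1.trans (h2.trans ?_)
    rw [mul_assoc]
    refine mul_le_mul_of_nonneg_left ?_ (by positivity)
    set B : ℝ := (q : ℝ) ^ ⌊A * Real.logb q (Fintype.card (V i))⌋₊
    have hB : 0 < B := by positivity
    have h3 := spectralSum_le_numCycles hq (hX i) ⌊A * Real.logb q (Fintype.card (V i))⌋₊
    refine le_of_mul_le_mul_left (h3.trans ((add_le_add_left (hC i) _).trans ?_)) hB
    have h4 := mul_le_mul_of_nonneg_left (hle i hε) (by positivity : 0 ≤ 3 * B)
    linarith

theorem numPrimitiveClasses_iff_numCycles (hq : 2 ≤ q) (hX : ∀ i, (X i).IsRegular (q + 1))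
    (hA0 : 0 ≤ A) (hA1 : A ≤ 1) :
    (∀ ε : ℝ, 0 < ε → ∃ C : ℝ, ∀ i,
        ((X i).numPrimitiveClasses (cycleLength q A (Fintype.card (V i))) : ℝ)
          ≤ C * (Fintype.card (V i) : ℝ) ^ (1 + ε)
            * (q : ℝ) ^ ⌊A * Real.logb q (Fintype.card (V i))⌋₊) ↔
      ∀ ε : ℝ, 0 < ε → ∃ C : ℝ, ∀ i,
        ((X i).numCycles (cycleLength q A (Fintype.card (V i))) : ℝ)
          ≤ C * (Fintype.card (V i) : ℝ) ^ (1 + ε)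
            * (q : ℝ) ^ ⌊A * Real.logb q (Fintype.card (V i))⌋₊ := by
  have hq1 : (1 : ℝ) < q := by exact_mod_cast hq
  constructor
  · intro H ε hε
    have hδ := half_pos hε
    obtain ⟨C, hC⟩ := H (ε / 2) hδ
    set K := (ε / 2 * Real.log q)⁻¹
    have hK : 0 ≤ K := inv_nonneg.mpr (mul_nonneg hδ.le (Real.log_nonneg hq1.le))
    -- With `j ≤ K n ^ (ε / 2)`, the primitive term `2 j π` spends one such factor beside the `ε /
    -- 2` of the hypothesis. The non-primitive term spends two, since `j (2 j + 1) ≤ 3 j ^ 2`.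
    refine ⟨2 * K * C + 3 * K ^ 2 * (q + 1), fun i => ?_⟩
    have hn1 := one_le_card (V i)
    have hj := floor_logb_le hq hA0 hA1 hn1 hδ
    have h1 := numCycles_two_mul_le (by omega) (hX i) ⌊A * Real.logb q (Fintype.card (V i))⌋₊
    have h2 := hC i
    rw [cycleLength] at h2 ⊢
    set n := (Fintype.card (V i) : ℝ)
    have hn0 : 0 < n := by linarith
    set j := ⌊A * Real.logb q n⌋₊
    set B : ℝ := (q : ℝ) ^ j
    have hB : 0 < B := by positivity
    have hjj : (j : ℝ) * (2 * j + 1) ≤ 3 * (K * n ^ (ε / 2)) ^ 2 := by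
      have h5 : (j : ℝ) ≤ (j : ℝ) ^ 2 := by exact_mod_cast Nat.le_self_pow two_ne_zero j
      have h6 : (j : ℝ) ^ 2 ≤ (K * n ^ (ε / 2)) ^ 2 :=
        pow_le_pow_left₀ (Nat.cast_nonneg j) hj 2
      nlinarith
    have h3 : 2 * (j : ℝ) * (X i).numPrimitiveClasses (2 * j)
        ≤ 2 * (K * n ^ (ε / 2)) * (C * n ^ (1 + ε / 2) * B) :=
      mul_le_mul (by linarith) h2 (Nat.cast_nonneg _) (by positivity)
    have h4 := mul_le_mul_of_nonneg_right hjj (by positivity : 0 ≤ ((q : ℝ) + 1) * n * B)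
    refine (h1.trans (add_le_add h3 h4)).trans_eq ?_
    have e1 : n ^ (1 + ε) = n * n ^ (ε / 2) * n ^ (ε / 2) := by
      rw [mul_assoc, ← Real.rpow_add hn0, add_halves, Real.rpow_add hn0, Real.rpow_one]
    have e2 : n ^ (1 + ε / 2) = n * n ^ (ε / 2) := by
      rw [Real.rpow_add hn0, Real.rpow_one]
    rw [e1, e2]
    ring
  · intro H ε hε
    obtain ⟨C, hC⟩ := H ε hε
    refine ⟨C, fun i => le_trans ?_ (hC i)⟩
    exact_mod_cast numPrimitiveClasses_le_numCycles (X i) _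

end Family

end DirGraph

theorem mainTheorem10 {ι : Type*} {V E : ι → Type*}
    [∀ i, Fintype (V i)] [∀ i, DecidableEq (V i)] [∀ i, Nonempty (V i)] [∀ i, Fintype (E i)]
    (q : ℕ) (hq : 2 ≤ q) (X : ∀ i, DirGraph (V i) (E i)) (hX : ∀ i, (X i).IsRegular (q + 1))
    (A : ℝ) (hA0 : 0 < A) (hA1 : A ≤ 1) :
    (SarnakXueDensity X q A ↔
      ∀ ε : ℝ, 0 < ε → ∃ C : ℝ, ∀ i : ι,
        ((X i).numPrimitiveClasses (cycleLength q A (Fintype.card (V i))) : ℝ)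
          ≤ C * (Fintype.card (V i) : ℝ) ^ (1 + ε)
            * (q : ℝ) ^ ((cycleLength q A (Fintype.card (V i)) : ℝ) / 2)) ∧
    (SarnakXueDensity X q A ↔
      ∀ ε : ℝ, 0 < ε → ∃ C : ℝ, ∀ i : ι,
        ((X i).numCycles (cycleLength q A (Fintype.card (V i))) : ℝ)
          ≤ C * (Fintype.card (V i) : ℝ) ^ (1 + ε)
            * (q : ℝ) ^ ((cycleLength q A (Fintype.card (V i)) : ℝ) / 2)) := by
  have hk : ∀ i, (q : ℝ) ^ ((cycleLength q A (Fintype.card (V i)) : ℝ) / 2)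
      = (q : ℝ) ^ ⌊A * Real.logb q (Fintype.card (V i))⌋₊ := fun i => by
    rw [cycleLength, Nat.cast_mul, Nat.cast_ofNat, mul_div_cancel_left₀ _ two_ne_zero,
      Real.rpow_natCast]
  simp only [hk]
  have h := (DirGraph.sarnakXueDensity_iff_spectralSum hq hX hA0.le hA1).trans
    (DirGraph.spectralSum_iff_numCycles hq hX hA0.le)
  exact ⟨h.trans (DirGraph.numPrimitiveClasses_iff_numCycles hq hX hA0.le hA1).symm, h⟩
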